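/- Let $F$ be a (real or complex) Banach space with a finite-dimensional decomposition (F.D.D.) $(F_i)_{i\in\mathbb N}$: the $F_i$ are finite-dimensional subspaces and every $x\in F$ is uniquely a norm-convergent series $x=\sum_i f_i$ with $f_i\in F_i$. For a nonempty finite interval $I\subseteq\mathbb N$ let $P_I x=\sum_{i\in I}f_i$, and let $K=\sup_n\|P_{[0,n]}\|$ be the constant of the decomposition. Let $E\subseteq F$ be a closed infinite-dimensional subspace with unit sphere $S_E$, and let $\Delta=(\delta_i)_{i\ge 0}$ be a decreasing sequence of positive reals converging to $0$. A sequence $(x_i)$ in $S_E$ is a $\Delta$-block with witness $(I_i)$ if $I_0<I_1<\cdots$ are nonempty intervals with $\|P_{I_i}x_i-x_i\|<\delta_i$ for all $i$. For a strictly increasing sequence $(m_i)$ of natural numbers, $R_\Delta(m_i,x_i)$ means that $(x_i)$ is a $\Delta$-block with a witness $(I_i)$ such that $m_0<I_0$ and for every $i$ there is $j$ with $I_i<m_j<m_{j+1}<I_{i+1}$. A $\Delta$-block tree is a nonempty set $T$ of finite strings in $S_E$, closed under initial segments, such that for every $(x_0,\dots,x_{n-1})\in T$ the set $\{y:(x_0,\dots,x_{n-1},y)\in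 T\}$ can be written as $\{y_i\}_{i\ge 0}$, where there are nonempty intervals $I_i\subseteq\mathbb N$ with $\|y_i-P_{I_i}y_i\|<\delta_n$ for all $i$ and $\min I_i\to\infty$. A branch of $T$ is an infinite sequence all of whose finite initial segments belong to $T$. For sequences $(x_i)$, $(y_i)$ in Banach spaces write $(x_i)\le^C(y_i)$ if $\|\sum_{i<n}a_ix_i\|\le C\|\sum_{i<n}a_iy_i\|$ for all $n$ and all scalars $a_i$; $(x_i)\ge^C(y_i)$ if $(y_i)\le^C(x_i)$; and $(x_i)\approx^C(y_i)$ if both hold. Write $\le,\ge,\approx$ if this is so for some $C$. Let $\mathcal A$ be a countable set of normalised Schauder bases of Banach spaces. (1) If every $\Delta$-block tree has a branch $(x_i)$ with $(x_i)\le(e_i)$ for some $(e_i)\in\mathcal A$, then there are a constant $C$, some $(e_i)\in\mathcal A$ and a strictly increasing sequence $(m_i)$ such that every $\Delta$-block $(x_i)$ in $E$ with $R_\Delta(m_i,x_i)$ satisfies $(x_i)\le^C(e_i)$. (2) If $\Delta$ is small relative to $K$, in the sense that $\sum_i\delta_i<\frac1{2K+1}$, then the same implication holds with $\ge$ and $\ge^C$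 in place of $\le$ and $\le^C$, and with $\approx$ and $\approx^C$ in place of $\le$ and $\le^C$. -/

import Mathlib

open Filter Topology

namespace AsymptoticGames

section

variable {𝕜 : Type*} [RCLike 𝕜] {F : Type*} [NormedAddCommGroup F] [NormedSpace 𝕜 F]

/-- `(S i)` is a finite-dimensional decomposition of `F`: every `S i` is a finite-dimensional
subspace and every `x` is in a unique way the norm limit of the partial sums of a series
`∑ i, f i` with `f i ∈ S i`. -/
structure IsFDD (S : ℕ → Submodule 𝕜 F) : Prop where
  finiteDimensional : ∀ i, FiniteDimensional 𝕜 (S i)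
  existsUnique_expansion : ∀ x : F, ∃! f : ℕ → F,
    (∀ i, f i ∈ S i) ∧ Tendsto (fun n => ∑ i ∈ Finset.range n, f i) atTop (𝓝 x)

/-- The `i`-th term of the expansion of `x`. -/
noncomputable def IsFDD.coord {S : ℕ → Submodule 𝕜 F} (hS : IsFDD S) (x : F) (i : ℕ) : F :=
  (hS.existsUnique_expansion x).choose i

/-- The projection `P_I x`, where `I = {a, a + 1, …, b}`. -/
noncomputable def IsFDD.proj {S : ℕ → Submodule 𝕜 F} (hS : IsFDD S) (a b : ℕ) (x : F) : F :=
  ∑ i ∈ Finset.Icc a b, hS.coord x i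

/-- `K` bounds the norms of all initial projections `x ↦ ∑_{i ≤ n} f i`; the least such `K` is the
constant of the decomposition. -/
def IsFDD.ConstantLE {S : ℕ → Submodule 𝕜 F} (hS : IsFDD S) (K : ℝ) : Prop :=
  ∀ (n : ℕ) (x : F), ‖hS.proj 0 n x‖ ≤ K * ‖x‖

/-- `Δ > 0`: a decreasing sequence of positive reals converging to `0`. -/
structure IsPosNull (δ : ℕ → ℝ) : Prop where
  antitone : Antitone δ
  pos : ∀ i, 0 < δ i
  tendsto_zero : Tendsto δ atTop (𝓝 0)

/-- All vectors of the sequence `x` lie in the unit sphere of `E`. -/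
def InSphere (E : Submodule 𝕜 F) (x : ℕ → F) : Prop :=
  ∀ i, x i ∈ E ∧ ‖x i‖ = 1

/-- The nonempty intervals `I i = [a i, b i]` satisfy `I 0 < I 1 < ⋯` and witness that `x` is a
`Δ`-block. -/
structure IsBlockWitness {S : ℕ → Submodule 𝕜 F} (hS : IsFDD S) (δ : ℕ → ℝ) (x : ℕ → F)
    (a b : ℕ → ℕ) : Prop where
  nonempty : ∀ i, a i ≤ b i
  lt : ∀ i, b i < a (i + 1)
  close : ∀ i, ‖hS.proj (a i) (b i) (x i) - x i‖ < δ i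

/-- `x` is an infinite `Δ`-block in `E`, that is, `x ∈ bb_{E,Δ}(S)`. -/
def IsBlock {S : ℕ → Submodule 𝕜 F} (hS : IsFDD S) (E : Submodule 𝕜 F) (δ : ℕ → ℝ)
    (x : ℕ → F) : Prop :=
  InSphere E x ∧ ∃ a b : ℕ → ℕ, IsBlockWitness hS δ x a b

/-- The relation `R(m_i, I_i)` for the intervals `I i = [a i, b i]`:
`m_0 < I_0`, and for every `i` there is `j` with `I_i < m_j < m_{j+1} < I_{i+1}`. -/
def SeparatedBy (m a b : ℕ → ℕ) : Prop :=
  m 0 < a 0 ∧ ∀ i, ∃ j, b i < m j ∧ m (j + 1) < a (i + 1)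

/-- The relation `R_Δ(m_i, x_i)`: `x` is a `Δ`-block with a witness `(I_i)` such that
`R(m_i, I_i)`. -/
def BlockSeparatedBy {S : ℕ → Submodule 𝕜 F} (hS : IsFDD S) (δ : ℕ → ℝ) (m : ℕ → ℕ)
    (x : ℕ → F) : Prop :=
  ∃ a b : ℕ → ℕ, IsBlockWitness hS δ x a b ∧ SeparatedBy m a b

/-- A `Δ`-block tree: a nonempty set of finite strings in the unit sphere of `E`, closed under
initial segments, such that the successors of every string of length `n` can be listed as
`{y 0, y 1, …}` with `‖y i - P_{I i} (y i)‖ < δ n` for intervals `I i` with `min (I i) → ∞`. -/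
structure IsBlockTree {S : ℕ → Submodule 𝕜 F} (hS : IsFDD S) (E : Submodule 𝕜 F) (δ : ℕ → ℝ)
    (T : Set (List F)) : Prop where
  nonempty : T.Nonempty
  mem_sphere : ∀ l ∈ T, ∀ v ∈ l, v ∈ E ∧ ‖v‖ = 1
  closed : ∀ l ∈ T, ∀ l', l' <+: l → l' ∈ T
  successors : ∀ l ∈ T, ∃ (y : ℕ → F) (a b : ℕ → ℕ),
    {v : F | l ++ [v] ∈ T} = Set.range y ∧
    (∀ i, a i ≤ b i) ∧
    (∀ i, ‖y i - hS.proj (a i) (b i) (y i)‖ < δ l.length) ∧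
    Tendsto a atTop atTop

/-- `x` is an infinite branch of `T`. -/
def IsBranch (T : Set (List F)) (x : ℕ → F) : Prop :=
  ∀ n, (List.range n).map x ∈ T

variable (𝕜) in
/-- `(x_i) ≤^C (y_i)`: `(y_i)` dominates (majorises) `(x_i)` with constant `C`. -/
def DominatedWith {X Y : Type*} [NormedAddCommGroup X] [NormedSpace 𝕜 X]
    [NormedAddCommGroup Y] [NormedSpace 𝕜 Y] (C : ℝ) (x : ℕ → X) (y : ℕ → Y) : Prop :=
  ∀ (c : ℕ → 𝕜) (n : ℕ),
    ‖∑ i ∈ Finset.range n, c i • x i‖ ≤ C * ‖∑ i ∈ Finset.range n, c i • y i‖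

variable (𝕜) in
/-- `(x_i) ≤ (y_i)`. -/
def Dominated {X Y : Type*} [NormedAddCommGroup X] [NormedSpace 𝕜 X]
    [NormedAddCommGroup Y] [NormedSpace 𝕜 Y] (x : ℕ → X) (y : ℕ → Y) : Prop :=
  ∃ C : ℝ, DominatedWith 𝕜 C x y

end

end AsymptoticGames

/-!
Consider the game in which the first player plays integers `n_i` and the second player answers with
unit vectors `x_i ∈ E` that are supported beyond `n_i` up to the error `δ_i`. For a fixed basis `e`
and a fixed constant, failure of the estimate between `x` and `e` is an open condition on the play,
so by the Gale–Stewart argument either the second player can force it or the first player has a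
strategy to prevent it. If at every position the second player could force the failure for every
basis and every constant, he could carry out these countably many tasks one after the other; the
plays against the resulting strategy would form a `Δ`-block tree all of whose branches violate the
hypothesis. So from some position on, the first player enforces the estimate for one basis and one
constant `C`.

Unit balls of finite-dimensional spaces being compact, up to errors `3 δ_i` there are only finitely
many vectors supported by an interval, hence only finitely many positions below a given bound. If
`m_{j+1}` exceeds the answers of the first player's strategy to all positions below `m_j`, then
every `x` with `R_Δ(m_i, x_i)` is within `3 δ_i` of a play following the strategy.

Such a perturbation and the finitely many vectors at the start preserve the estimate, as soon as
the sequence that majorises dominates the multiples `δ_i u_i` of the unit vectors of `ℓ¹`. For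
`e` this holds because otherwise the second player could, by adding multiples of one fixed vector
`z` of size proportional to `δ_i`, make `x ≤ e` fail; for blocks `x` it is a consequence of
`(2K+1) ∑ δ_i < 1`.
-/

namespace AsymptoticGames

section FDD

variable {𝕜 : Type*} [RCLike 𝕜] {F : Type*} [NormedAddCommGroup F] [NormedSpace 𝕜 F]
  {S : ℕ → Submodule 𝕜 F}

namespace IsFDD

lemma coord_mem (hS : IsFDD S) (x : F) (i : ℕ) : hS.coord x i ∈ S i :=
  (hS.existsUnique_expansion x).choose_spec.1.1 i

lemma tendsto_sum_coord (hS : IsFDD S) (x : F) :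
    Tendsto (fun n => ∑ i ∈ Finset.range n, hS.coord x i) atTop (𝓝 x) :=
  (hS.existsUnique_expansion x).choose_spec.1.2

lemma coord_eq_of_tendsto (hS : IsFDD S) {x : F} {f : ℕ → F} (hf : ∀ i, f i ∈ S i)
    (h : Tendsto (fun n => ∑ i ∈ Finset.range n, f i) atTop (𝓝 x)) : hS.coord x = f :=
  (hS.existsUnique_expansion x).unique ⟨hS.coord_mem x, hS.tendsto_sum_coord x⟩ ⟨hf, h⟩

lemma coord_add (hS : IsFDD S) (x y : F) : hS.coord (x + y) = hS.coord x + hS.coord y := by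
  refine hS.coord_eq_of_tendsto (fun i => (S i).add_mem (hS.coord_mem x i) (hS.coord_mem y i)) ?_
  simpa [Finset.sum_add_distrib] using (hS.tendsto_sum_coord x).add (hS.tendsto_sum_coord y)

lemma coord_smul (hS : IsFDD S) (c : 𝕜) (x : F) : hS.coord (c • x) = c • hS.coord x := by
  refine hS.coord_eq_of_tendsto (fun i => (S i).smul_mem c (hS.coord_mem x i)) ?_
  simpa [Finset.smul_sum] using (hS.tendsto_sum_coord x).const_smul c

/-- The projection `P_I` onto the interval `I = {a, a + 1, …, b}`, bundled as a linear map. -/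
noncomputable def projₗ (hS : IsFDD S) (a b : ℕ) : F →ₗ[𝕜] F where
  toFun := hS.proj a b
  map_add' x y := by simp [proj, coord_add, Finset.sum_add_distrib]
  map_smul' c x := by simp [proj, coord_smul, Finset.smul_sum]

lemma proj_add (hS : IsFDD S) (a b : ℕ) (x y : F) :
    hS.proj a b (x + y) = hS.proj a b x + hS.proj a b y :=
  map_add (hS.projₗ a b) x y

lemma proj_smul (hS : IsFDD S) (a b : ℕ) (c : 𝕜) (x : F) :
    hS.proj a b (c • x) = c • hS.proj a b x :=
  map_smul (hS.projₗ a b) c x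

lemma proj_sum_smul (hS : IsFDD S) (a b : ℕ) {ι : Type*} (s : Finset ι) (c : ι → 𝕜) (x : ι → F) :
    hS.proj a b (∑ i ∈ s, c i • x i) = ∑ i ∈ s, c i • hS.proj a b (x i) := by
  simp only [← proj_smul]
  exact map_sum (hS.projₗ a b) (fun i => c i • x i) s

lemma proj_mem_iSup (hS : IsFDD S) (a b : ℕ) (x : F) :
    hS.proj a b x ∈ ⨆ i ∈ Finset.Icc a b, S i :=
  Submodule.sum_mem _ fun i hi =>
    (le_iSup₂ (f := fun i (_ : i ∈ Finset.Icc a b) => S i) i hi) (hS.coord_mem x i)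

lemma finiteDimensional_iSup (hS : IsFDD S) (a b : ℕ) :
    FiniteDimensional 𝕜 (⨆ i ∈ Finset.Icc a b, S i : Submodule 𝕜 F) := by
  have := hS.finiteDimensional
  rw [← Finset.sup_eq_iSup]
  exact Submodule.finiteDimensional_finset_sup _ _

lemma coord_proj (hS : IsFDD S) (a b : ℕ) (x : F) :
    hS.coord (hS.proj a b x) = fun i => if i ∈ Finset.Icc a b then hS.coord x i else 0 := by
  refine hS.coord_eq_of_tendsto (fun i => ?_) ?_
  · split_ifs
    · exact hS.coord_mem x i
    · exact (S i).zero_mem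
  · refine tendsto_const_nhds.congr' ?_
    filter_upwards [eventually_gt_atTop b] with n hn
    rw [← Finset.sum_filter, proj]
    refine Finset.sum_congr ?_ fun _ _ => rfl
    ext i
    simp only [Finset.mem_Icc, Finset.mem_filter, Finset.mem_range]
    omega

lemma proj_proj_self (hS : IsFDD S) (a b : ℕ) (x : F) :
    hS.proj a b (hS.proj a b x) = hS.proj a b x := by
  conv_lhs => rw [proj, coord_proj]
  exact Finset.sum_congr rfl fun _ hi => if_pos hi

lemma proj_proj_of_disjoint (hS : IsFDD S) {a b c d : ℕ} (x : F)
    (h : Disjoint (Finset.Icc a b) (Finset.Icc c d)) : hS.proj a b (hS.proj c d x) = 0 := by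
  rw [proj, coord_proj]
  exact Finset.sum_eq_zero fun i hi => if_neg (Finset.disjoint_left.1 h hi)

lemma tendsto_proj_zero (hS : IsFDD S) (x : F) :
    Tendsto (fun n => hS.proj 0 n x) atTop (𝓝 x) := by
  refine ((hS.tendsto_sum_coord x).comp (tendsto_add_atTop_nat 1)).congr fun n => ?_
  simp [proj, Nat.range_succ_eq_Icc_zero]

lemma proj_zero_add_proj (hS : IsFDD S) {a b : ℕ} (hab : a ≤ b) (x : F) :
    hS.proj 0 a x + hS.proj (a + 1) b x = hS.proj 0 b x := by
  have hdisj : Disjoint (Finset.Icc 0 a) (Finset.Icc (a + 1) b) := by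
    rw [Finset.disjoint_left]
    intro i
    simp only [Finset.mem_Icc]
    omega
  rw [proj, proj, ← Finset.sum_union hdisj]
  refine Finset.sum_congr ?_ fun _ _ => rfl
  ext i
  simp only [Finset.mem_Icc, Finset.mem_union]
  omega

lemma ConstantLE.nonneg {hS : IsFDD S} {K : ℝ} (hK : hS.ConstantLE K) {x : F} (hx : 0 < ‖x‖) :
    0 ≤ K :=
  nonneg_of_mul_nonneg_left ((norm_nonneg _).trans (hK 0 x)) hx

lemma ConstantLE.norm_proj_le {hS : IsFDD S} {K : ℝ} (hK : hS.ConstantLE K) (a b : ℕ) (x : F) :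
    ‖hS.proj a b x‖ ≤ 2 * K * ‖x‖ := by
  have h_nonneg : 0 ≤ K * ‖x‖ := (norm_nonneg _).trans (hK 0 x)
  rcases lt_or_ge b a with hba | hab
  · rw [proj, Finset.Icc_eq_empty (by omega), Finset.sum_empty, norm_zero]
    linarith
  · cases a with
    | zero => linarith [hK b x]
    | succ a =>
      rw [← sub_eq_of_eq_add' (hS.proj_zero_add_proj (by omega) x).symm]
      linarith [norm_sub_le (hS.proj 0 b x) (hS.proj 0 a x), hK b x, hK a x]

/-- The sequences of partial sums of convergent series `∑ i, f i` with `f i ∈ S i`, together with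
their limits: a subspace of the space of convergent sequences in `F`, which is encoded as
`C(OnePoint ℕ, F)`. -/
def partialSums (S : ℕ → Submodule 𝕜 F) : Submodule 𝕜 C(OnePoint ℕ, F) where
  carrier := {g | g ((0 : ℕ) : OnePoint ℕ) = 0 ∧
    ∀ n : ℕ, g ((n + 1 : ℕ) : OnePoint ℕ) - g (n : OnePoint ℕ) ∈ S n}
  zero_mem' := ⟨rfl, fun n => by simp⟩
  add_mem' {f g} hf hg := ⟨by simp [hf.1, hg.1], fun n => by
    simpa [add_sub_add_comm] using (S n).add_mem (hf.2 n) (hg.2 n)⟩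
  smul_mem' c f hf := ⟨by simp [hf.1], fun n => by
    simpa [smul_sub] using (S n).smul_mem c (hf.2 n)⟩

lemma isClosed_partialSums (hS : IsFDD S) : IsClosed (partialSums S : Set C(OnePoint ℕ, F)) := by
  have := hS.finiteDimensional
  have h_inter : (partialSums S : Set C(OnePoint ℕ, F)) =
      {g | g ((0 : ℕ) : OnePoint ℕ) = 0} ∩
        ⋂ n : ℕ, {g | g ((n + 1 : ℕ) : OnePoint ℕ) - g (n : OnePoint ℕ) ∈ S n} := by
    ext g
    simp only [Set.mem_inter_iff, Set.mem_iInter]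
    rfl
  rw [h_inter]
  refine (isClosed_eq (continuous_eval_const _) continuous_const).inter
    (isClosed_iInter fun n => ?_)
  exact (S n).closed_of_finiteDimensional.preimage
    ((continuous_eval_const _).sub (continuous_eval_const _))

lemma proj_zero_apply_infty (hS : IsFDD S) {g : C(OnePoint ℕ, F)} (hg : g ∈ partialSums S)
    (n : ℕ) : hS.proj 0 n (g OnePoint.infty) = g ((n + 1 : ℕ) : OnePoint ℕ) := by
  have h_sum : ∀ n : ℕ, ∑ i ∈ Finset.range n, (g ((i + 1 : ℕ) : OnePoint ℕ) - g (i : OnePoint ℕ)) =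
      g (n : OnePoint ℕ) := fun n => by
    rw [Finset.sum_range_sub (fun i : ℕ => g (i : OnePoint ℕ)), hg.1, sub_zero]
  have h_coord : hS.coord (g OnePoint.infty) =
      fun i : ℕ => g ((i + 1 : ℕ) : OnePoint ℕ) - g (i : OnePoint ℕ) := by
    refine hS.coord_eq_of_tendsto hg.2 ?_
    simp only [h_sum]
    exact (OnePoint.continuous_iff_from_nat g).1 g.continuous
  rw [proj, h_coord, ← Nat.range_succ_eq_Icc_zero, h_sum]

lemma exists_mem_partialSums (hS : IsFDD S) (x : F) :
    ∃ g ∈ partialSums S, g OnePoint.infty = x := by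
  refine ⟨OnePoint.continuousMapMkNat (fun n => ∑ i ∈ Finset.range n, hS.coord x i) x
    (hS.tendsto_sum_coord x), ⟨Finset.sum_range_zero (hS.coord x), fun n => ?_⟩, rfl⟩
  change ∑ i ∈ Finset.range (n + 1), hS.coord x i - ∑ i ∈ Finset.range n, hS.coord x i ∈ S n
  rw [Finset.sum_range_succ_sub_sum]
  exact hS.coord_mem x n

theorem exists_constantLE [CompleteSpace F] (hS : IsFDD S) : ∃ K, hS.ConstantLE K := by
  have : CompleteSpace (partialSums S) := hS.isClosed_partialSums.completeSpace_coe
  let limit : partialSums S →L[𝕜] F :=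
    (ContinuousMap.evalCLM 𝕜 OnePoint.infty).comp (partialSums S).subtypeL
  have h_surj : Function.Surjective limit := fun x =>
    let ⟨g, hg, hgx⟩ := hS.exists_mem_partialSums x
    ⟨⟨g, hg⟩, hgx⟩
  obtain ⟨K, -, hK⟩ := limit.exists_preimage_norm_le h_surj
  refine ⟨K, fun n x => ?_⟩
  obtain ⟨g, rfl, hg⟩ := hK x
  calc ‖hS.proj 0 n (limit g)‖ = ‖g.1 ((n + 1 : ℕ) : OnePoint ℕ)‖ := by
        rw [← hS.proj_zero_apply_infty g.2]
        rfl
    _ ≤ ‖g.1‖ := g.1.norm_coe_le_norm _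
    _ ≤ K * ‖limit g‖ := hg

end IsFDD

end FDD

section Game

variable {α : Type*}

/-- The sequence `x_p, x_{p+1}, …`. -/
def tail (p : ℕ) (x : ℕ → α) (i : ℕ) : α := x (p + i)

/-- The set `W` of plays is open in the topology of finite initial segments, for the discrete
topology on the set of moves: membership in `W` is already decided by finitely many moves. -/
def IsPrefixOpen (W : Set (ℕ → α)) : Prop := ∀ x ∈ W, ∃ n, PiNat.cylinder x n ⊆ W

lemma IsPrefixOpen.union {V W : Set (ℕ → α)} (hV : IsPrefixOpen V) (hW : IsPrefixOpen W) :
    IsPrefixOpen (V ∪ W) := by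
  rintro x (hx | hx)
  · exact (hV x hx).imp fun n hn => hn.trans Set.subset_union_left
  · exact (hW x hx).imp fun n hn => hn.trans Set.subset_union_right

lemma IsPrefixOpen.preimage_tail {W : Set (ℕ → α)} (hW : IsPrefixOpen W) (p : ℕ) :
    IsPrefixOpen (tail p ⁻¹' W) := fun x hx => by
  obtain ⟨n, hn⟩ := hW _ hx
  exact ⟨p + n, fun y hy => hn fun i hi => hy (p + i) (by omega)⟩

lemma drop_res (x : ℕ → α) (p d : ℕ) : (PiNat.res x (p + d)).drop d = PiNat.res x p := by
  induction d with
  | zero => rfl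
  | succ d ih => rw [← Nat.add_assoc, PiNat.res_succ, List.drop_succ_cons, ih]

/-- The set of plays that extend the position `r`. As for `PiNat.res`, positions list the moves
made so far, the last one first. -/
def extensions (r : List α) : Set (ℕ → α) := {x | PiNat.res x r.length = r}

lemma mem_extensions_res {x y : ℕ → α} {n : ℕ} :
    y ∈ extensions (PiNat.res x n) ↔ ∀ i < n, y i = x i := by
  rw [extensions, Set.mem_ofPred_eq, PiNat.res_length, PiNat.res_eq_res]

lemma mem_extensions_cons {x : ℕ → α} {r : List α} (hx : x ∈ extensions r) :
    x ∈ extensions (x r.length :: r) := by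
  rw [extensions, Set.mem_ofPred_eq, List.length_cons, PiNat.res_succ, hx]

lemma extensions_nonempty [Nonempty α] (r : List α) : (extensions r).Nonempty := by
  induction r with
  | nil => exact ⟨fun _ => Classical.arbitrary α, rfl⟩
  | cons y r ih =>
    obtain ⟨x, hx⟩ := ih
    refine ⟨Function.update x r.length y, ?_⟩
    have hagree : PiNat.res (Function.update x r.length y) r.length = PiNat.res x r.length :=
      PiNat.res_eq_res.2 fun i hi => Function.update_of_ne hi.ne _ _
    rw [extensions, Set.mem_ofPred_eq, List.length_cons, PiNat.res_succ, hagree, hx,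
      Function.update_self]

/-- `Φ` is a strategy for the second player, giving the answer `Φ s n` to the move `n` of the first
player in the position `s`; here `L i n` is the set of legal answers after `i` rounds. -/
def IsStrategy (L : ℕ → ℕ → Set α) (Φ : List α → ℕ → α) : Prop :=
  ∀ s n, Φ s n ∈ L s.length n

/-- The answers in `x` follow the strategy `Φ` from the round `p` on. -/
def FollowsFrom (Φ : List α → ℕ → α) (p : ℕ) (x : ℕ → α) : Prop :=
  ∀ i, p ≤ i → x i ∈ Set.range (Φ (PiNat.res x i))

/-- From the position `r` the second player can force the play into `W`. -/
def Forces (L : ℕ → ℕ → Set α) (W : Set (ℕ → α)) (r : List α) : Prop :=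
  ∃ Φ, IsStrategy L Φ ∧ ∀ x ∈ extensions r, FollowsFrom Φ r.length x → x ∈ W

variable {L : ℕ → ℕ → Set α} {W : Set (ℕ → α)} {r : List α}

lemma Forces.mono {V : Set (ℕ → α)} (hVW : V ⊆ W) (h : Forces L V r) : Forces L W r := by
  obtain ⟨Φ, hΦ, hwin⟩ := h
  exact ⟨Φ, hΦ, fun x hr hx => hVW (hwin x hr hx)⟩

lemma Forces.of_moves (Q : ℕ → α → Prop) (hQ : ∀ i n, ∃ y ∈ L i n, Q i y)
    (hW : ∀ x ∈ extensions r, (∀ i, r.length ≤ i → Q i (x i)) → x ∈ W) : Forces L W r := by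
  choose y hyL hyQ using hQ
  refine ⟨fun s => y s.length, fun s => hyL s.length, fun x hr hx => hW x hr fun i hi => ?_⟩
  obtain ⟨n, hn⟩ := hx i hi
  rw [← hn]
  simpa only [PiNat.res_length] using hyQ i n

lemma Forces.of_forall (hL : ∀ i n, (L i n).Nonempty)
    (h : ∀ n, ∃ y ∈ L r.length n, Forces L W (y :: r)) : Forces L W r := by
  have hstrategy : ∀ t, ∃ Ψ, IsStrategy L Ψ ∧
      (Forces L W t → ∀ x ∈ extensions t, FollowsFrom Ψ t.length x → x ∈ W) := fun t => by
    by_cases ht : Forces L W t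
    · exact ht.imp fun Ψ hΨ => ⟨hΨ.1, fun _ => hΨ.2⟩
    · choose z hz using hL
      exact ⟨fun s => z s.length, fun s => hz s.length, fun h => absurd h ht⟩
  choose Ψ hΨ hwin using hstrategy
  choose y hy hforces using h
  let first (s : List α) : List α := s.drop (s.length - (r.length + 1))
  refine ⟨fun s n => if s.length = r.length then y n else Ψ (first s) s n, fun s n => ?_,
    fun x hr hx => ?_⟩
  · dsimp only
    split_ifs with hs
    · exact hs ▸ hy n
    · exact hΨ _ s n
  · obtain ⟨n, hn⟩ : ∃ n, y n = x r.length := by simpa using hx r.length le_rfl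
    refine hwin (x r.length :: r) (hn ▸ hforces n) x (mem_extensions_cons hr) fun i hi => ?_
    rw [List.length_cons] at hi
    have hfirst : first (PiNat.res x i) = x r.length :: r := by
      obtain ⟨d, rfl⟩ := Nat.exists_eq_add_of_le hi
      simp only [first, PiNat.res_length, Nat.add_sub_cancel_left, drop_res, PiNat.res_succ]
      rw [hr]
    have hxi := hx i (by omega)
    simp only [PiNat.res_length, show i ≠ r.length by omega, if_false, hfirst] at hxi
    exact hxi

/-- The Gale–Stewart argument: a first player who avoids the positions from which the second player
can force the open set `W` keeps the play outside `W`. -/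
lemma exists_avoiding_of_not_forces (hL : ∀ i n, (L i n).Nonempty) (hW : IsPrefixOpen W)
    (hr : ¬ Forces L W r) : ∃ g : List α → ℕ, ∀ x ∈ extensions r,
      (∀ i, r.length ≤ i → x i ∈ L i (g (PiNat.res x i))) → x ∉ W := by
  have havoid : ∀ s, ∃ n, ¬ Forces L W s → ∀ y ∈ L s.length n, ¬ Forces L W (y :: s) := by
    intro s
    by_contra! h
    exact (h 0).1 (.of_forall hL fun n => (h n).2)
  choose g hg using havoid
  refine ⟨g, fun x hx hxg hxW => ?_⟩
  have hnot : ∀ i, r.length ≤ i → ¬ Forces L W (PiNat.res x i) := by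
    intro i hi
    induction i, hi using Nat.le_induction with
    | base => rwa [hx]
    | succ i hi ih => exact hg _ ih _ (by simpa using hxg i hi)
  obtain ⟨n, hn⟩ := hW x hxW
  exact hnot (max n r.length) (le_max_right _ _) <|
    .of_moves (fun _ _ => True) (fun i n => (hL i n).imp fun _ hy => ⟨hy, trivial⟩)
      fun y hy _ => hn fun i hi => mem_extensions_res.1 hy i (lt_max_of_lt_left hi)

open Classical in
/-- The bookkeeping of a second player who works on the requirements `W 0, W 1, …` one after the
other: the index of the current requirement and the position in which the work on it began. The
player turns to the next requirement once the current one is met by all extensions of the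
position. -/
noncomputable def currentTask (W : ℕ → ℕ → Set (ℕ → α)) : List α → ℕ × List α
  | [] => (0, [])
  | y :: s =>
    if extensions (y :: s) ⊆ W (currentTask W s).1 (currentTask W s).2.length then
      ((currentTask W s).1 + 1, y :: s)
    else currentTask W s

lemma exists_currentTask_succ {W : ℕ → ℕ → Set (ℕ → α)} (hW : ∀ j p, IsPrefixOpen (W j p))
    {Ψ : ℕ → List α → List α → ℕ → α} (hΨ : ∀ j s, ∀ x ∈ extensions s,
      FollowsFrom (Ψ j s) s.length x → x ∈ W j s.length) {x : ℕ → α}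
    (hx : ∀ i, x i ∈ Set.range (Ψ (currentTask W (PiNat.res x i)).1
      (currentTask W (PiNat.res x i)).2 (PiNat.res x i))) {i j : ℕ}
    (hi : currentTask W (PiNat.res x i) = (j, PiNat.res x i)) :
    x ∈ W j i ∧ ∃ k, currentTask W (PiNat.res x k) = (j + 1, PiNat.res x k) := by
  classical
  have hstay : ∀ k, i ≤ k → (∀ l, i ≤ l → l < k → ¬ extensions (PiNat.res x (l + 1)) ⊆ W j i) →
      currentTask W (PiNat.res x k) = (j, PiNat.res x i) := by
    intro k hk hundecided
    induction k, hk using Nat.le_induction with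
    | base => exact hi
    | succ k hk ih =>
      have ih := ih fun l hl hlk => hundecided l hl (by omega)
      have hk := hundecided k hk k.lt_succ_self
      rw [PiNat.res_succ] at hk ⊢
      rw [currentTask, ih, if_neg (by simpa using hk)]
  have hdecided : ∃ k, i ≤ k ∧ extensions (PiNat.res x (k + 1)) ⊆ W j i := by
    by_contra! hundecided
    have hxW : x ∈ W j i := by
      simpa using hΨ j (PiNat.res x i) x (mem_extensions_res.2 fun _ _ => rfl) fun k hk => by
        simpa only [hstay k (by simpa using hk) fun l hl _ => hundecided l hl] using hx k
    obtain ⟨n, hn⟩ := hW j i x hxW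
    exact hundecided (max n i) (le_max_right _ _) fun y hy =>
      hn fun l hl => mem_extensions_res.1 hy l (by omega)
  obtain ⟨hik, hk⟩ := Nat.find_spec hdecided
  refine ⟨hk (mem_extensions_res.2 fun _ _ => rfl), Nat.find hdecided + 1, ?_⟩
  have htask := hstay _ hik fun l hl hlk h => Nat.find_min hdecided hlk ⟨hl, h⟩
  rw [PiNat.res_succ] at hk ⊢
  rw [currentTask, htask, if_pos (by simpa using hk)]

lemma exists_strategy_forall {J : Type*} [Countable J] (hL : ∀ i n, (L i n).Nonempty)
    {W : J → ℕ → Set (ℕ → α)} (hW : ∀ j p, IsPrefixOpen (W j p))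
    (hforces : ∀ j r, Forces L (W j r.length) r) :
    ∃ Φ, IsStrategy L Φ ∧ ∀ x, FollowsFrom Φ 0 x → ∀ j, ∃ p, x ∈ W j p := by
  rcases isEmpty_or_nonempty J with _ | _
  · choose y hy using hL
    exact ⟨fun s => y s.length, fun s => hy s.length, fun _ _ j => isEmptyElim j⟩
  obtain ⟨f, hf⟩ := exists_surjective_nat J
  choose Ψ hΨ hwin using fun j r => hforces (f j) r
  let V : ℕ → ℕ → Set (ℕ → α) := fun j => W (f j)
  refine ⟨fun s => Ψ (currentTask V s).1 (currentTask V s).2 s, fun s => hΨ _ _ s, ?_⟩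
  intro x hx
  have hstep : ∀ {i j : ℕ}, currentTask V (PiNat.res x i) = (j, PiNat.res x i) →
      x ∈ V j i ∧ ∃ k, currentTask V (PiNat.res x k) = (j + 1, PiNat.res x k) :=
    exists_currentTask_succ (fun j => hW (f j)) hwin fun i => hx i i.zero_le
  have hreach : ∀ j, ∃ i, currentTask V (PiNat.res x i) = (j, PiNat.res x i) := by
    intro j
    induction j with
    | zero => exact ⟨0, rfl⟩
    | succ j ih =>
      obtain ⟨i, hi⟩ := ih
      exact (hstep hi).2
  intro j
  obtain ⟨k, rfl⟩ := hf j
  obtain ⟨i, hi⟩ := hreach k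
  exact ⟨i, (hstep hi).1⟩

lemma reverse_map_range_eq_res (x : ℕ → α) (n : ℕ) :
    ((List.range n).map x).reverse = PiNat.res x n := by
  induction n with
  | zero => rfl
  | succ n ih => simp [List.range_succ, ih]

lemma mem_res {x : ℕ → α} {n : ℕ} {y : α} : y ∈ PiNat.res x n ↔ ∃ i < n, x i = y := by
  simp [← reverse_map_range_eq_res]

/-- The tree of all finite plays in which the second player follows `Φ`. As for `IsBlockTree`, the
strings list the moves in their order, so they are reversed when `Φ` is applied. -/
def strategyTree (Φ : List α → ℕ → α) : Set (List α) :=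
  {l | ∀ l' v, l' ++ [v] <+: l → v ∈ Set.range (Φ l'.reverse)}

lemma IsBranch.followsFrom {Φ : List α → ℕ → α} {x : ℕ → α} (hx : IsBranch (strategyTree Φ) x) :
    FollowsFrom Φ 0 x := fun n _ => by
  rw [← reverse_map_range_eq_res]
  exact hx (n + 1) _ _ (by simp [List.range_succ])

end Game

section BlockTree

variable {𝕜 : Type*} [RCLike 𝕜] {F : Type*} [NormedAddCommGroup F] [NormedSpace 𝕜 F]
  {S : ℕ → Submodule 𝕜 F} {E : Submodule 𝕜 F} {δ : ℕ → ℝ}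

/-- The vectors of `S_E` that are supported by the interval `[a, b]` up to an error less than
`ε`. -/
def nearlySupported (hS : IsFDD S) (E : Submodule 𝕜 F) (ε : ℝ) (a b : ℕ) : Set F :=
  {y | y ∈ E ∧ ‖y‖ = 1 ∧ ‖y - hS.proj a b y‖ < ε}

lemma nearlySupported_mono (hS : IsFDD S) {ε ε' : ℝ} (hε : ε ≤ ε') (a b : ℕ) :
    nearlySupported hS E ε a b ⊆ nearlySupported hS E ε' a b :=
  fun _ hy => ⟨hy.1, hy.2.1, hy.2.2.trans_le hε⟩

/-- The legal answers to the move `n` of the first player after `i` rounds of the game whose plays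
are `Δ`-blocks up to the order of the intervals: the first player prescribes how far away the next
vector is supported. -/
def legalMoves (hS : IsFDD S) (E : Submodule 𝕜 F) (δ : ℕ → ℝ) (i n : ℕ) : Set F :=
  {y | ∃ a b, n < a ∧ a ≤ b ∧ y ∈ nearlySupported hS E (δ i) a b}

lemma isBlockTree_strategyTree (hS : IsFDD S) {Φ : List F → ℕ → F}
    (hΦ : IsStrategy (legalMoves hS E δ) Φ) : IsBlockTree hS E δ (strategyTree Φ) where
  nonempty := ⟨[], fun l' v h => by simp at h⟩
  mem_sphere l hl v hv := by
    obtain ⟨s, t, rfl⟩ := List.append_of_mem hv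
    obtain ⟨n, rfl⟩ := hl s v ⟨t, by simp⟩
    obtain ⟨a, b, -, -, h⟩ := hΦ s.reverse n
    exact ⟨h.1, h.2.1⟩
  closed l hl l' h l'' v h' := hl l'' v (h'.trans h)
  successors l hl := by
    choose a b ha hab h using hΦ l.reverse
    refine ⟨Φ l.reverse, a, b, ?_, hab, fun i => by simpa using (h i).2.2,
      tendsto_atTop_mono (fun n => (ha n).le) tendsto_id⟩
    ext v
    refine ⟨fun hv => hv l v List.prefix_rfl, fun hv l' w hw => ?_⟩
    rcases List.prefix_concat_iff.1 hw with hw | hw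
    · obtain ⟨rfl, hvw⟩ := List.append_inj' hw rfl
      obtain rfl : w = v := by simpa using hvw
      exact hv
    · exact hl l' w hw

lemma exists_norm_eq_one_map_eq_zero (hE : ¬ FiniteDimensional 𝕜 E) {V : Type*} [AddCommGroup V]
    [Module 𝕜 V] [FiniteDimensional 𝕜 V] (f : F →ₗ[𝕜] V) : ∃ y ∈ E, ‖y‖ = 1 ∧ f y = 0 := by
  obtain ⟨y, hfy, hy⟩ : ∃ y, f.domRestrict E y = 0 ∧ y ≠ 0 := by
    by_contra! h
    exact hE (.of_injective (f.domRestrict E) ((injective_iff_map_eq_zero _).2 h))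
  have hy0 : (y : F) ≠ 0 := fun h => hy (Subtype.ext h)
  have hfy : f y = 0 := hfy
  exact ⟨((‖(y : F)‖⁻¹ : ℝ) : 𝕜) • (y : F), E.smul_mem _ y.2, by
    simpa using norm_smul_inv_norm (𝕜 := 𝕜) hy0, by rw [map_smul, hfy, smul_zero]⟩

lemma exists_mem_nearlySupported (hS : IsFDD S) (hE : ¬ FiniteDimensional 𝕜 E) {ε : ℝ}
    (hε : 0 < ε) (n : ℕ) (φ : F →ₗ[𝕜] 𝕜) :
    ∃ b, n + 1 ≤ b ∧ ∃ y ∈ nearlySupported hS E ε (n + 1) b, φ y = 0 := by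
  have := hS.finiteDimensional_iSup 0 n
  obtain ⟨y, hyE, hy1, hy⟩ := exists_norm_eq_one_map_eq_zero hE
    (((hS.projₗ 0 n).codRestrict _ (hS.proj_mem_iSup 0 n)).prod φ)
  have hproj : hS.proj 0 n y = 0 := congrArg (fun v => (v.1 : F)) hy
  have hclose : ∀ᶠ b in atTop, ‖hS.proj 0 b y - y‖ < ε := by
    simpa [dist_eq_norm] using (hS.tendsto_proj_zero y).eventually (Metric.ball_mem_nhds y hε)
  obtain ⟨b, hb, hnb⟩ := (hclose.and (eventually_ge_atTop (n + 1))).exists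
  refine ⟨b, hnb, y, ⟨hyE, hy1, ?_⟩, congrArg Prod.snd hy⟩
  rwa [← hS.proj_zero_add_proj (by omega : n ≤ b), hproj, zero_add, norm_sub_rev] at hb

lemma legalMoves_nonempty (hS : IsFDD S) (hE : ¬ FiniteDimensional 𝕜 E) (hδ : ∀ i, 0 < δ i)
    (i n : ℕ) : (legalMoves hS E δ i n).Nonempty := by
  obtain ⟨b, hb, y, hy, -⟩ := exists_mem_nearlySupported hS hE (hδ i) n 0
  exact ⟨y, n + 1, b, n.lt_succ_self, hb, hy⟩

end BlockTree

section Separation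

lemma SeparatedBy.lt {m a b : ℕ → ℕ} (h : SeparatedBy m a b) (hm : StrictMono m) (i : ℕ) :
    b i < a (i + 1) := by
  obtain ⟨j, hbj, hja⟩ := h.2 i
  exact hbj.trans ((hm j.lt_succ_self).trans hja)

lemma strictMono_of_forall_lt {a b : ℕ → ℕ} (hab : ∀ i, a i ≤ b i) (hlt : ∀ i, b i < a (i + 1)) :
    StrictMono b :=
  strictMono_nat_of_lt_succ fun i => (hlt i).trans_le (hab _)

lemma exists_bound_of_finite {α : Type*} {U : Set α} (hU : U.Finite) (g : List α → ℕ) (l : ℕ) :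
    ∃ M, ∀ s : List α, s.length ≤ l → (∀ y ∈ s, y ∈ U) → g s ≤ M := by
  have := hU.to_subtype
  obtain ⟨M, hM⟩ := ((List.finite_length_le U l).image fun s => g (s.map Subtype.val)).bddAbove
  refine ⟨M, fun s hs hsU => hM ⟨s.attach.map fun y => ⟨y.1, hsU y.1 y.2⟩, by simpa using hs, ?_⟩⟩
  simp [List.map_map, Function.comp_def]

/-- Between two consecutive values `m j` and `m (j + 1)` there is room for all bounds on `g` that
arise from positions composed of intervals below `m j`, as there are only finitely many of these. -/
lemma exists_strictMono_forall_res_lt {α : Type*} {N : ℕ → ℕ → ℕ → Set α}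
    (hN : ∀ i a b, (N i a b).Finite) (g : List α → ℕ) :
    ∃ m : ℕ → ℕ, StrictMono m ∧ ∀ a b : ℕ → ℕ, (∀ i, a i ≤ b i) → SeparatedBy m a b →
      ∀ x : ℕ → α, (∀ i, x i ∈ N i (a i) (b i)) → ∀ i, g (PiNat.res x i) < a i := by
  let U (l : ℕ) : Set α := ⋃ i ∈ Set.Iic l, ⋃ a ∈ Set.Iic l, ⋃ b ∈ Set.Iic l, N i a b
  have hU : ∀ l, (U l).Finite := fun l =>
    (Set.finite_Iic l).biUnion fun i _ => (Set.finite_Iic l).biUnion fun a _ =>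
      (Set.finite_Iic l).biUnion fun b _ => hN i a b
  choose f hf using fun l => exists_bound_of_finite (hU l) g l
  let m : ℕ → ℕ := Nat.rec (g []) fun _ k => max (k + 1) (f k)
  have hm : ∀ j, m (j + 1) = max (m j + 1) (f (m j)) := fun j => rfl
  have hmono : StrictMono m := strictMono_nat_of_lt_succ fun j => by rw [hm]; omega
  refine ⟨m, hmono, fun a b hab hsep x hx i => ?_⟩
  have hb : StrictMono b := strictMono_of_forall_lt hab (hsep.lt hmono)
  cases i with
  | zero => exact hsep.1
  | succ i =>
    obtain ⟨j, hbj, hja⟩ := hsep.2 i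
    have hib : i ≤ b i := hb.le_apply
    refine lt_of_le_of_lt (le_trans ?_ (hm j ▸ le_max_right _ _)) hja
    refine hf _ _ (by rw [PiNat.res_length]; omega) fun y hy => ?_
    obtain ⟨k, hk, rfl⟩ := mem_res.1 hy
    have hbk : b k ≤ b i := hb.monotone (by omega)
    have hak := hab k
    simp only [U, Set.mem_iUnion, Set.mem_Iic, exists_prop]
    exact ⟨k, by omega, a k, by omega, b k, by omega, hx k⟩

variable {𝕜 : Type*} [RCLike 𝕜] {F : Type*} [NormedAddCommGroup F] [NormedSpace 𝕜 F]
  {S : ℕ → Submodule 𝕜 F} {hS : IsFDD S} {E : Submodule 𝕜 F} {δ : ℕ → ℝ} {K : ℝ}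

lemma exists_finite_net (hK : hS.ConstantLE K) (E : Submodule 𝕜 F) {ε : ℝ} (hε : 0 < ε)
    (a b : ℕ) : ∃ N ⊆ nearlySupported hS E ε a b, N.Finite ∧
      ∀ y ∈ nearlySupported hS E ε a b, ∃ y' ∈ N, ‖y - y'‖ ≤ 3 * ε := by
  let V : Submodule 𝕜 F := ⨆ i ∈ Finset.Icc a b, S i
  have : FiniteDimensional 𝕜 V := hS.finiteDimensional_iSup a b
  have : ProperSpace V := FiniteDimensional.proper_rclike 𝕜 V
  have htb : TotallyBounded (hS.proj a b '' nearlySupported hS E ε a b) := by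
    refine ((isCompact_closedBall (0 : V) (2 * K)).image
      continuous_subtype_val).totallyBounded.subset ?_
    rintro _ ⟨y, hy, rfl⟩
    refine ⟨⟨hS.proj a b y, hS.proj_mem_iSup a b y⟩, ?_, rfl⟩
    simpa [hy.2.1] using hK.norm_proj_le a b y
  obtain ⟨t, ht, htfin, hcover⟩ := Metric.finite_approx_of_totallyBounded htb ε hε
  obtain ⟨N, hN, hNfin, rfl⟩ := htfin.exists_subset_finite_image_eq ht
  refine ⟨N, hN, hNfin, fun y hy => ?_⟩
  have hy_ball := hcover ⟨y, hy, rfl⟩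
  simp only [Set.mem_iUnion, Metric.mem_ball, exists_prop, Set.exists_mem_image] at hy_ball
  obtain ⟨y', hy'N, hlt⟩ := hy_ball
  refine ⟨y', hy'N, ?_⟩
  calc ‖y - y'‖ ≤ ‖y - hS.proj a b y‖ + ‖hS.proj a b y - hS.proj a b y'‖
        + ‖hS.proj a b y' - y'‖ := by
        simpa only [dist_eq_norm] using dist_triangle4 y (hS.proj a b y) (hS.proj a b y') y'
    _ ≤ ε + ε + ε := by
        gcongr
        · exact hy.2.2.le
        · exact (dist_eq_norm _ _).symm.trans_le hlt.le
        · exact (norm_sub_rev _ _).trans_le (hN hy'N).2.2.le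
    _ = 3 * ε := by ring

lemma exists_separating (hK : hS.ConstantLE K) (hE : ¬ FiniteDimensional 𝕜 E)
    (hδ : ∀ i, 0 < δ i) {W : Set (ℕ → F)} (hW : IsPrefixOpen W) {r : List F}
    (hr : ¬ Forces (legalMoves hS E δ) (tail r.length ⁻¹' W) r) :
    ∃ m : ℕ → ℕ, StrictMono m ∧ ∀ x, InSphere E x → BlockSeparatedBy hS δ m x →
      ∃ w, InSphere E w ∧ (∀ i, ‖x i - w i‖ ≤ 3 * δ i) ∧ tail r.length w ∉ W := by
  classical
  obtain ⟨g, hg⟩ :=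
    exists_avoiding_of_not_forces (legalMoves_nonempty hS hE hδ) (hW.preimage_tail _) hr
  obtain ⟨x₀, hx₀⟩ := extensions_nonempty r
  choose N hNsub hNfin hN using fun i a b => exists_finite_net hK E (hδ i) a b
  obtain ⟨m, hm, hsep⟩ := exists_strictMono_forall_res_lt
    (N := fun i a b => if i < r.length then {x₀ i} else N i a b)
    (fun i a b => by split_ifs; exacts [Set.finite_singleton _, hNfin i a b]) g
  refine ⟨m, hm, fun x hx ⟨a, b, hw, hab⟩ => ?_⟩
  choose w hwN hxw using fun i => hN i (a i) (b i) (x i)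
    ⟨(hx i).1, (hx i).2, (norm_sub_rev _ _).trans_lt (hw.close i)⟩
  have hwsupp := fun i => hNsub i (a i) (b i) (hwN i)
  let x' (i : ℕ) : F := if i < r.length then x₀ i else w i
  have hx' : ∀ i, r.length ≤ i → x' i = w i := fun i hi => if_neg hi.not_gt
  have hext : x' ∈ extensions r := by
    rw [← hx₀]
    exact mem_extensions_res.2 fun i hi => if_pos hi
  have hlt := hsep a b hw.nonempty hab x' fun i => by
    dsimp only [x']
    split_ifs
    exacts [rfl, hwN i]
  have hlegal : ∀ i, r.length ≤ i → x' i ∈ legalMoves hS E δ i (g (PiNat.res x' i)) :=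
    fun i hi => ⟨a i, b i, hlt i, hw.nonempty i, hx' i hi ▸ hwsupp i⟩
  have htail : tail r.length x' = tail r.length w := funext fun i => hx' _ (Nat.le_add_right _ _)
  exact ⟨w, fun i => ⟨(hwsupp i).1, (hwsupp i).2.1⟩, hxw, htail ▸ hg x' hext hlegal⟩

/-- The sets `A j p` stand for the estimates between a tail `x_p, x_{p+1}, …` and the corresponding
tail of a basis, where `j` encodes the basis and the constant. -/
lemma exists_not_forces_and_separating (hK : hS.ConstantLE K) (hE : ¬ FiniteDimensional 𝕜 E)
    (hδ : ∀ i, 0 < δ i) {J : Type*} [Countable J] {A : J → ℕ → Set (ℕ → F)}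
    (hA : ∀ j p, IsPrefixOpen (A j p)ᶜ)
    (htree : ∀ T, IsBlockTree hS E δ T → ∃ x, IsBranch T x ∧ ∃ j, ∀ p, tail p x ∈ A j p) :
    ∃ j r, ¬ Forces (legalMoves hS E δ) (tail r.length ⁻¹' (A j r.length)ᶜ) r ∧
      ∃ m : ℕ → ℕ, StrictMono m ∧ ∀ x, InSphere E x → BlockSeparatedBy hS δ m x →
        ∃ w, InSphere E w ∧ (∀ i, ‖x i - w i‖ ≤ 3 * δ i) ∧ tail r.length w ∈ A j r.length := by
  suffices h : ∃ j r, ¬ Forces (legalMoves hS E δ) (tail r.length ⁻¹' (A j r.length)ᶜ) r by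
    obtain ⟨j, r, hr⟩ := h
    have hsep := exists_separating hK hE hδ (hA j r.length) hr
    simp only [Set.notMem_compl_iff] at hsep
    exact ⟨j, r, hr, hsep⟩
  by_contra! hforces
  obtain ⟨Φ, hΦ, hplay⟩ := exists_strategy_forall (legalMoves_nonempty hS hE hδ)
    (fun j p => (hA j p).preimage_tail p) hforces
  obtain ⟨x, hx, j, hj⟩ := htree _ (isBlockTree_strategyTree hS hΦ)
  obtain ⟨p, hp⟩ := hplay x hx.followsFrom j
  exact hp (hj p)

end Separation

section Domination

variable {𝕜 : Type*} [RCLike 𝕜] {X Y Z : Type*} [NormedAddCommGroup X] [NormedSpace 𝕜 X]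
  [NormedAddCommGroup Y] [NormedSpace 𝕜 Y] [NormedAddCommGroup Z] [NormedSpace 𝕜 Z]
  {x : ℕ → X} {y : ℕ → Y} {z : ℕ → Z} {C D M : ℝ} {δ B α β : ℕ → ℝ}

lemma DominatedWith.refl (x : ℕ → X) : DominatedWith 𝕜 1 x x := fun _ _ => (one_mul _).ge

lemma DominatedWith.mono (h : DominatedWith 𝕜 C x y) (hCD : C ≤ D) : DominatedWith 𝕜 D x y :=
  fun c n => (h c n).trans (by gcongr)

lemma DominatedWith.trans (hC : 0 ≤ C) (hxy : DominatedWith 𝕜 C x y)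
    (hyz : DominatedWith 𝕜 D y z) : DominatedWith 𝕜 (C * D) x z := fun c n => by
  rw [mul_assoc]
  exact (hxy c n).trans (by gcongr; exact hyz c n)

lemma Dominated.exists_nat (h : Dominated 𝕜 x y) : ∃ C : ℕ, DominatedWith 𝕜 C x y := by
  obtain ⟨D, hD⟩ := h
  exact (exists_nat_ge D).imp fun C hC => hD.mono hC

lemma isPrefixOpen_compl_setOf_dominatedWith_left (C : ℝ) (y : ℕ → Y) :
    IsPrefixOpen {x : ℕ → X | DominatedWith 𝕜 C x y}ᶜ := fun x hx => by
  simp only [DominatedWith, Set.mem_compl_iff, Set.mem_ofPred_eq, not_forall] at hx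
  obtain ⟨c, n, hlt⟩ := hx
  refine ⟨n, fun x' hx' h => hlt ?_⟩
  rw [← Finset.sum_congr rfl fun i hi => congrArg (c i • ·) (hx' i (Finset.mem_range.1 hi))]
  exact h c n

lemma isPrefixOpen_compl_setOf_dominatedWith_right (C : ℝ) (x : ℕ → X) :
    IsPrefixOpen {y : ℕ → Y | DominatedWith 𝕜 C x y}ᶜ := fun y hy => by
  simp only [DominatedWith, Set.mem_compl_iff, Set.mem_ofPred_eq, not_forall] at hy
  obtain ⟨c, n, hlt⟩ := hy
  refine ⟨n, fun y' hy' h => hlt ?_⟩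
  rw [← Finset.sum_congr rfl fun i hi => congrArg (c i • ·) (hy' i (Finset.mem_range.1 hi))]
  exact h c n

lemma sum_range_add_smul (c : ℕ → 𝕜) (p n : ℕ) (x : ℕ → X) :
    ∑ i ∈ Finset.range (p + n), c i • x i =
      ∑ i ∈ Finset.range p, c i • x i + ∑ i ∈ Finset.range n, c (p + i) • tail p x i :=
  Finset.sum_range_add _ p n

protected lemma DominatedWith.tail (h : DominatedWith 𝕜 C x y) (p : ℕ) :
    DominatedWith 𝕜 C (tail p x) (tail p y) := fun c n => by
  let c' (i : ℕ) : 𝕜 := if i < p then 0 else c (i - p)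
  have hhead : ∀ i ∈ Finset.range p, c' i = 0 := fun i hi => if_pos (Finset.mem_range.1 hi)
  have hx : ∑ i ∈ Finset.range p, c' i • x i = 0 :=
    Finset.sum_eq_zero fun i hi => by rw [hhead i hi, zero_smul]
  have hy : ∑ i ∈ Finset.range p, c' i • y i = 0 :=
    Finset.sum_eq_zero fun i hi => by rw [hhead i hi, zero_smul]
  have htail : ∀ i, c' (p + i) = c i := fun i => by simp [c']
  simpa only [sum_range_add_smul, htail, hx, hy, zero_add] using h c' (p + n)

/-- The coefficients in linear combinations of `v` are continuous, with bounds `B i`. -/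
def CoeffBound (𝕜 : Type*) [RCLike 𝕜] {X : Type*} [NormedAddCommGroup X] [NormedSpace 𝕜 X]
    (B : ℕ → ℝ) (v : ℕ → X) : Prop :=
  ∀ (c : ℕ → 𝕜) (n : ℕ), ∀ i < n, ‖c i‖ ≤ B i * ‖∑ j ∈ Finset.range n, c j • v j‖

lemma coeffBound_schauderBasis (b : SchauderBasis 𝕜 X) :
    CoeffBound 𝕜 (fun i => ‖b.coord i‖) b := fun c n i hi => by
  have hcoord : b.coord i (∑ j ∈ Finset.range n, c j • b j) = c i := by
    simp [map_sum, b.ortho, Pi.single_apply, hi]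
  simpa only [hcoord] using (b.coord i).le_opNorm (∑ j ∈ Finset.range n, c j • b j)

lemma CoeffBound.norm_sum_le (hB : CoeffBound 𝕜 B y) (hx : ∀ i, ‖x i‖ ≤ α i) (c : ℕ → 𝕜)
    (p n : ℕ) : ‖∑ i ∈ Finset.range p, c i • x i‖ ≤
      (∑ i ∈ Finset.range p, α i * B i) * ‖∑ i ∈ Finset.range (p + n), c i • y i‖ := by
  rw [Finset.sum_mul]
  refine norm_sum_le_of_le _ fun i hi => ?_
  have hα : 0 ≤ α i := (norm_nonneg _).trans (hx i)
  rw [norm_smul, mul_comm, mul_assoc]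
  gcongr
  · exact hx i
  · exact hB c _ i (Nat.lt_add_right n (Finset.mem_range.1 hi))

lemma DominatedWith.of_forall_add (p : ℕ) (h : ∀ (c : ℕ → 𝕜) n,
    ‖∑ i ∈ Finset.range (p + n), c i • x i‖ ≤ C * ‖∑ i ∈ Finset.range (p + n), c i • y i‖) :
    DominatedWith 𝕜 C x y := fun c n => by
  have hsum := h (fun i => if i < n then c i else 0) n
  simp only [ite_smul, zero_smul, ← Finset.sum_filter] at hsum
  have hrange : (Finset.range (p + n)).filter (· < n) = Finset.range n := by
    ext i
    simp only [Finset.mem_filter, Finset.mem_range]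
    omega
  rwa [hrange] at hsum

lemma DominatedWith.of_tail {p : ℕ} (hC : 0 ≤ C) (hB : CoeffBound 𝕜 B y)
    (hx : ∀ i, ‖x i‖ ≤ α i) (hy : ∀ i, ‖y i‖ ≤ β i)
    (h : DominatedWith 𝕜 C (tail p x) (tail p y)) :
    DominatedWith 𝕜 (∑ i ∈ Finset.range p, α i * B i +
      C * (1 + ∑ i ∈ Finset.range p, β i * B i)) x y := by
  refine .of_forall_add p fun c n => ?_
  have htail := h (fun i => c (p + i)) n
  have hxhead := hB.norm_sum_le hx c p n
  have hyhead := hB.norm_sum_le hy c p n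
  have hsum := sum_range_add_smul c p n y
  rw [sum_range_add_smul c p n x]
  set u := ∑ i ∈ Finset.range p, c i • x i
  set v := ∑ i ∈ Finset.range p, c i • y i
  set w := ∑ i ∈ Finset.range (p + n), c i • y i
  calc _ ≤ ‖u‖ + C * ‖w - v‖ := by
        rw [hsum, add_sub_cancel_left]
        exact (norm_add_le _ _).trans (by gcongr)
    _ ≤ ‖u‖ + C * (‖w‖ + ‖v‖) := by gcongr; exact norm_sub_le _ _
    _ ≤ _ * ‖w‖ + C * (‖w‖ + _ * ‖w‖) := by gcongr
    _ = _ := by ring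

variable (𝕜) in
/-- The multiples `δ i • e i` of the unit vectors of `ℓ¹`. That a sequence `z` dominates them is a
lower `ℓ¹`-estimate `∑ i, δ i * ‖c i‖ ≤ D * ‖∑ i, c i • z i‖`. -/
noncomputable def weightedL1Basis (δ : ℕ → ℝ) (i : ℕ) : lp (fun _ : ℕ => 𝕜) 1 :=
  lp.single 1 i (δ i : 𝕜)

lemma norm_sum_weightedL1Basis (hδ : ∀ i, 0 ≤ δ i) (c : ℕ → 𝕜) (s : Finset ℕ) :
    ‖∑ i ∈ s, c i • weightedL1Basis 𝕜 δ i‖ = ∑ i ∈ s, δ i * ‖c i‖ := by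
  have h := lp.norm_sum_single (p := 1) (by simp) (fun i => c i * (δ i : 𝕜)) s
  simp only [ENNReal.toReal_one, Real.rpow_one, norm_mul, RCLike.norm_ofReal] at h
  simp only [weightedL1Basis, ← lp.single_smul, smul_eq_mul, h]
  exact Finset.sum_congr rfl fun i _ => by rw [abs_of_nonneg (hδ i), mul_comm]

lemma norm_sum_tail_weightedL1Basis (hδ : ∀ i, 0 ≤ δ i) (c : ℕ → 𝕜) (p n : ℕ) :
    ‖∑ i ∈ Finset.range n, c i • tail p (weightedL1Basis 𝕜 δ) i‖ =
      ∑ i ∈ Finset.range n, δ (p + i) * ‖c i‖ := by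
  simpa only [tail, Finset.sum_map, addLeftEmbedding_apply, Nat.add_sub_cancel_left] using
    norm_sum_weightedL1Basis hδ (fun i => c (i - p)) ((Finset.range n).map (addLeftEmbedding p))

lemma DominatedWith.perturb (hδ : ∀ i, 0 ≤ δ i) (hM : 0 ≤ M) {x y : ℕ → X}
    (hxy : ∀ i, ‖x i - y i‖ ≤ M * δ i) (hy : DominatedWith 𝕜 C y z)
    (hz : DominatedWith 𝕜 D (weightedL1Basis 𝕜 δ) z) : DominatedWith 𝕜 (C + M * D) x z := by
  intro c n
  have hdiff : ‖∑ i ∈ Finset.range n, c i • x i - ∑ i ∈ Finset.range n, c i • y i‖ ≤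
      M * ∑ i ∈ Finset.range n, δ i * ‖c i‖ := by
    rw [← Finset.sum_sub_distrib, Finset.mul_sum]
    refine norm_sum_le_of_le _ fun i _ => ?_
    rw [← smul_sub, norm_smul, ← mul_assoc, mul_comm]
    gcongr
    exact hxy i
  have hl1 := hz c n
  rw [norm_sum_weightedL1Basis hδ] at hl1
  have hyz := hy c n
  calc _ ≤ ‖∑ i ∈ Finset.range n, c i • y i‖ + M * ∑ i ∈ Finset.range n, δ i * ‖c i‖ :=
        norm_le_norm_add_const_of_dist_le (by rwa [dist_eq_norm])
    _ ≤ C * _ + M * (D * _) := by gcongr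
    _ = _ := by ring

lemma DominatedWith.coeffBound (hδ : ∀ i, 0 < δ i)
    (h : DominatedWith 𝕜 D (weightedL1Basis 𝕜 δ) z) : CoeffBound 𝕜 (fun i => D / δ i) z := by
  intro c n i hi
  have hl1 := h c n
  rw [norm_sum_weightedL1Basis fun i => (hδ i).le] at hl1
  rw [div_mul_eq_mul_div, le_div_iff₀' (hδ i)]
  exact (Finset.single_le_sum (f := fun i => δ i * ‖c i‖)
    (fun j _ => mul_nonneg (hδ j).le (norm_nonneg _)) (Finset.mem_range.2 hi)).trans hl1

end Domination

section LowerEstimate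

variable {𝕜 : Type*} [RCLike 𝕜] {F : Type*} [NormedAddCommGroup F] [NormedSpace 𝕜 F]
  {S : ℕ → Submodule 𝕜 F} {hS : IsFDD S} {δ : ℕ → ℝ} {K : ℝ} {x : ℕ → F} {a b : ℕ → ℕ}

namespace IsBlockWitness

lemma pos (hx : IsBlockWitness hS δ x a b) (i : ℕ) : 0 < δ i :=
  (norm_nonneg _).trans_lt (hx.close i)

lemma disjoint_Icc (hx : IsBlockWitness hS δ x a b) {i j : ℕ} (hij : i ≠ j) :
    Disjoint (Finset.Icc (a i) (b i)) (Finset.Icc (a j) (b j)) := by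
  wlog hlt : i < j generalizing i j
  · exact (this hij.symm (hij.lt_or_gt.resolve_left hlt)).symm
  have ha : StrictMono a := strictMono_nat_of_lt_succ fun k => (hx.nonempty k).trans_lt (hx.lt k)
  have hab : b i < a j := (hx.lt i).trans_le (ha.monotone hlt)
  rw [Finset.disjoint_left]
  simp only [Finset.mem_Icc]
  omega

lemma proj_sum_smul_proj (hx : IsBlockWitness hS δ x a b) (c : ℕ → 𝕜) {s : Finset ℕ} {k : ℕ}
    (hk : k ∈ s) : hS.proj (a k) (b k) (∑ i ∈ s, c i • hS.proj (a i) (b i) (x i)) =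
      c k • hS.proj (a k) (b k) (x k) := by
  rw [hS.proj_sum_smul, Finset.sum_eq_single_of_mem k hk, hS.proj_proj_self]
  intro i _ hik
  rw [hS.proj_proj_of_disjoint _ (hx.disjoint_Icc hik.symm), smul_zero]

lemma norm_coeff_le (hx : IsBlockWitness hS δ x a b) (hK : hS.ConstantLE K)
    (hnorm : ∀ i, ‖x i‖ = 1) (c : ℕ → 𝕜) {s : Finset ℕ} {k : ℕ} (hk : k ∈ s) :
    ‖c k‖ ≤ 2 * K * ‖∑ i ∈ s, c i • x i‖ + (2 * K + 1) * ∑ i ∈ s, δ i * ‖c i‖ := by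
  set u := ∑ i ∈ s, c i • x i
  set v := ∑ i ∈ s, c i • hS.proj (a i) (b i) (x i)
  set t := ∑ i ∈ s, δ i * ‖c i‖
  have hK0 : 0 ≤ K := hK.nonneg (x := x 0) (by simp [hnorm])
  have hsum : ‖v - u‖ ≤ t := by
    rw [← Finset.sum_sub_distrib]
    refine norm_sum_le_of_le _ fun i _ => ?_
    rw [← smul_sub, norm_smul, mul_comm]
    gcongr
    exact (hx.close i).le
  have hterm : δ k * ‖c k‖ ≤ t :=
    Finset.single_le_sum (f := fun i => δ i * ‖c i‖)
      (fun i _ => mul_nonneg (hx.pos i).le (norm_nonneg _)) hk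
  calc ‖c k‖ = ‖c k • x k‖ := by rw [norm_smul, hnorm, mul_one]
    _ ≤ ‖c k • hS.proj (a k) (b k) (x k)‖ + ‖c k • hS.proj (a k) (b k) (x k) - c k • x k‖ :=
        norm_le_norm_add_norm_sub _ _
    _ ≤ 2 * K * ‖v‖ + δ k * ‖c k‖ := by
        gcongr
        · rw [← hx.proj_sum_smul_proj c hk]
          exact hK.norm_proj_le _ _ _
        · rw [← smul_sub, norm_smul, mul_comm]
          gcongr
          exact (hx.close k).le
    _ ≤ 2 * K * (‖u‖ + t) + t := by
        gcongr
        exact (norm_le_norm_add_norm_sub' v u).trans (by gcongr)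
    _ = _ := by ring

lemma weightedL1Basis_dominatedWith (hx : IsBlockWitness hS δ x a b) (hK : hS.ConstantLE K)
    (hnorm : ∀ i, ‖x i‖ = 1) (hδ : Summable δ) (hsmall : (2 * K + 1) * ∑' i, δ i < 1) :
    DominatedWith 𝕜 (2 * K * (∑' i, δ i) / (1 - (2 * K + 1) * ∑' i, δ i))
      (weightedL1Basis 𝕜 δ) x := by
  intro c n
  rw [norm_sum_weightedL1Basis fun i => (hx.pos i).le]
  set u := ∑ i ∈ Finset.range n, c i • x i
  set t := ∑ i ∈ Finset.range n, δ i * ‖c i‖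
  have hK0 : 0 ≤ K := hK.nonneg (x := x 0) (by simp [hnorm])
  have ht0 : 0 ≤ t := Finset.sum_nonneg fun i _ => mul_nonneg (hx.pos i).le (norm_nonneg _)
  have habsorb : t ≤ (∑' i, δ i) * (2 * K * ‖u‖ + (2 * K + 1) * t) := calc
    t ≤ ∑ i ∈ Finset.range n, δ i * (2 * K * ‖u‖ + (2 * K + 1) * t) :=
        Finset.sum_le_sum fun i hi =>
          mul_le_mul_of_nonneg_left (hx.norm_coeff_le hK hnorm c hi) (hx.pos i).le
    _ ≤ _ := by
        rw [← Finset.sum_mul]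
        gcongr
        exact hδ.sum_le_tsum _ fun i _ => (hx.pos i).le
  rw [div_mul_eq_mul_div, le_div_iff₀ (sub_pos.2 hsmall)]
  linarith

end IsBlockWitness

lemma IsBlock.weightedL1Basis_dominatedWith {E : Submodule 𝕜 F} (hx : IsBlock hS E δ x)
    (hK : hS.ConstantLE K) (hδ : Summable δ) (hsmall : (2 * K + 1) * ∑' i, δ i < 1) :
    DominatedWith 𝕜 (2 * K * (∑' i, δ i) / (1 - (2 * K + 1) * ∑' i, δ i))
      (weightedL1Basis 𝕜 δ) x := by
  obtain ⟨hsphere, a, b, hab⟩ := hx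
  exact hab.weightedL1Basis_dominatedWith hK (fun i => (hsphere i).2) hδ hsmall

end LowerEstimate

section Forcing

variable {𝕜 : Type*} [RCLike 𝕜] {F : Type*} [NormedAddCommGroup F] [NormedSpace 𝕜 F]
  {S : ℕ → Submodule 𝕜 F} {hS : IsFDD S} {E : Submodule 𝕜 F} {δ : ℕ → ℝ} {K : ℝ}

lemma half_le_norm_add {y u : F} (hy : ‖y‖ = 1) (hu : ‖u‖ ≤ 1 / 2) : 1 / 2 ≤ ‖y + u‖ := by
  linarith [norm_sub_le (y + u) u, congrArg norm (add_sub_cancel_right y u)]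

lemma inv_norm_smul_add_mem_nearlySupported (hK : hS.ConstantLE K) {ε t : ℝ} {a b : ℕ} {y u : F}
    (hy : y ∈ nearlySupported hS E ε a b) (hu : u ∈ E) (hut : ‖u‖ ≤ t) (ht : t ≤ 1 / 2) :
    ((‖y + u‖⁻¹ : ℝ) : 𝕜) • (y + u) ∈ nearlySupported hS E (2 * (ε + (1 + 2 * K) * t)) a b := by
  obtain ⟨hyE, hy1, hyε⟩ := hy
  have hK0 : 0 ≤ K := hK.nonneg (x := y) (by simp [hy1])
  have hv : 1 / 2 ≤ ‖y + u‖ := half_le_norm_add hy1 (hut.trans ht)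
  have hclose : ‖y + u - hS.proj a b (y + u)‖ < ε + (1 + 2 * K) * t := by
    have hsplit : y + u - hS.proj a b (y + u) = (y - hS.proj a b y) + (u - hS.proj a b u) := by
      rw [hS.proj_add]
      abel
    calc _ ≤ ‖y - hS.proj a b y‖ + (‖u‖ + ‖hS.proj a b u‖) := by
          rw [hsplit]
          exact (norm_add_le _ _).trans (by gcongr; exact norm_sub_le _ _)
      _ < ε + (t + 2 * K * t) :=
          add_lt_add_of_lt_of_le hyε
            (add_le_add hut ((hK.norm_proj_le a b u).trans (by gcongr)))
      _ = _ := by ring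
  refine ⟨E.smul_mem _ (E.add_mem hyE hu), ?_, ?_⟩
  · simpa using norm_smul_inv_norm (𝕜 := 𝕜) (x := y + u) (norm_pos_iff.1 (by linarith))
  · rw [hS.proj_smul, ← smul_sub, norm_smul, RCLike.norm_ofReal, abs_of_nonneg (by positivity)]
    have hinv : ‖y + u‖⁻¹ ≤ 2 := inv_le_of_inv_le₀ two_pos (by linarith)
    calc _ ≤ 2 * ‖y + u - hS.proj a b (y + u)‖ := by gcongr
      _ < _ := by gcongr

/-- Far out there is a vector in the kernel of `φ`; adding a small multiple of `z` to it prescribes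
the argument of its value under `φ`. -/
lemma exists_mem_legalMoves_map_eq (hK : hS.ConstantLE K) (hE : ¬ FiniteDimensional 𝕜 E)
    {φ : StrongDual 𝕜 F} {z : F} (hzE : z ∈ E) (hz : ‖z‖ = 1) (hφz : φ z = 1) {i : ℕ} {t : ℝ}
    (hδ : 0 < δ i) (ht0 : 0 ≤ t) (ht : t ≤ 1 / 2) (htδ : (1 + 2 * K) * t ≤ δ i / 4)
    {τ : 𝕜} (hτ : ‖τ‖ = 1) (n : ℕ) :
    ∃ y ∈ legalMoves hS E δ i n, ∃ s : ℝ, t / 2 ≤ s ∧ φ y = s * τ := by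
  obtain ⟨b, hb, y, hy, hφy⟩ :=
    exists_mem_nearlySupported hS hE (div_pos hδ four_pos) n (φ : F →ₗ[𝕜] 𝕜)
  set u : F := ((t : 𝕜) * τ) • z
  have hu : ‖u‖ = t := by simp [u, norm_smul, hτ, hz, abs_of_nonneg ht0]
  have hv : 1 / 2 ≤ ‖y + u‖ := half_le_norm_add hy.2.1 (hu.trans_le ht)
  have hv2 : ‖y + u‖ ≤ 2 := by linarith [norm_add_le y u, hy.2.1]
  refine ⟨_, ⟨n + 1, b, n.lt_succ_self, hb, nearlySupported_mono hS ?_ _ _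
    (inv_norm_smul_add_mem_nearlySupported hK hy (E.smul_mem _ hzE) hu.le ht)⟩,
    ‖y + u‖⁻¹ * t, ?_, ?_⟩
  · linarith
  · rw [div_eq_inv_mul]
    gcongr
  · have hφu : φ (y + u) = t * τ := by
      rw [map_add, show φ y = 0 from hφy, zero_add, map_smul, hφz, smul_eq_mul, mul_one]
    rw [map_smul, hφu, smul_eq_mul, ← mul_assoc]
    push_cast
    rfl

lemma exists_dual_forall_exists_legalMoves (hK : hS.ConstantLE K) (hE : ¬ FiniteDimensional 𝕜 E)
    (hδ : ∀ i, 0 < δ i) (hbdd : BddAbove (Set.range δ)) :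
    ∃ φ : StrongDual 𝕜 F, ‖φ‖ = 1 ∧ ∃ θ > 0, ∀ τ : 𝕜, ‖τ‖ = 1 → ∀ i n,
      ∃ y ∈ legalMoves hS E δ i n, ∃ s : ℝ, θ * δ i ≤ s ∧ φ y = s * τ := by
  obtain ⟨z, hzE, hz, -⟩ := exists_norm_eq_one_map_eq_zero hE (0 : F →ₗ[𝕜] 𝕜)
  obtain ⟨φ, hφ, hφz⟩ := exists_dual_vector 𝕜 z (norm_ne_zero_iff.1 (by simp [hz]))
  have hK0 : 0 ≤ K := hK.nonneg (x := z) (by simp [hz])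
  obtain ⟨L, hL⟩ := hbdd
  have hδL : ∀ i, δ i ≤ L := fun i => hL ⟨i, rfl⟩
  have hL0 : 0 < L := (hδ 0).trans_le (hδL 0)
  set M : ℝ := 4 * (1 + 2 * K) + 2 * L
  have hM : 0 < M := by positivity
  refine ⟨φ, hφ, 1 / (2 * M), by positivity, fun τ hτ i n => ?_⟩
  have hδi := hδ i
  rw [show 1 / (2 * M) * δ i = δ i / M / 2 by field_simp]
  refine exists_mem_legalMoves_map_eq hK hE hzE hz (by simp [hφz, hz]) hδi (by positivity)
    ?_ ?_ hτ n
  · rw [div_le_iff₀ hM]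
    linarith [hδL i]
  · rw [mul_div_assoc', div_le_iff₀ hM]
    nlinarith

lemma forces_not_dominatedWith (hK : hS.ConstantLE K) (hE : ¬ FiniteDimensional 𝕜 E)
    (hδ : ∀ i, 0 < δ i) (hbdd : BddAbove (Set.range δ)) {X : Type*} [NormedAddCommGroup X]
    [NormedSpace 𝕜 X] {e : ℕ → X} {B : ℕ → ℝ} (hB : CoeffBound 𝕜 B e)
    (he : ¬ Dominated 𝕜 (weightedL1Basis 𝕜 δ) e) {C : ℝ} (hC : 0 ≤ C) (r : List F) :
    Forces (legalMoves hS E δ)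
      {x | ¬ DominatedWith 𝕜 C (tail r.length x) (tail r.length e)} r := by
  obtain ⟨φ, hφ, θ, hθ, hmove⟩ := exists_dual_forall_exists_legalMoves hK hE hδ hbdd
  obtain ⟨c, n, hcn⟩ : ∃ (c : ℕ → 𝕜) (n : ℕ), C * ‖∑ i ∈ Finset.range n, c i • tail r.length e i‖ <
      θ * ∑ i ∈ Finset.range n, δ (r.length + i) * ‖c i‖ := by
    by_contra! h
    refine he ⟨_, .of_tail (p := r.length) (C := C / θ) (by positivity) hB
      (fun _ => le_rfl) (fun _ => le_rfl) fun c n => ?_⟩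
    rw [norm_sum_tail_weightedL1Basis fun i => (hδ i).le, div_mul_eq_mul_div, le_div_iff₀' hθ]
    exact h c n
  choose τ hτ hτc using fun i => RCLike.exists_norm_eq_mul_self (c i)
  refine .of_moves (fun i y => ∃ s : ℝ, θ * δ i ≤ s ∧ φ y = s * τ (i - r.length))
    (fun i n => hmove _ (hτ _) i n) fun x _ hx hdom => (hdom c n).not_gt (hcn.trans_le ?_)
  choose s hs hφs using fun i => hx (r.length + i) (Nat.le_add_right _ i)
  calc θ * ∑ i ∈ Finset.range n, δ (r.length + i) * ‖c i‖
      ≤ ∑ i ∈ Finset.range n, s i * ‖c i‖ := by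
        rw [Finset.mul_sum]
        refine Finset.sum_le_sum fun i _ => ?_
        rw [← mul_assoc]
        gcongr
        exact hs i
    _ = RCLike.re (φ (∑ i ∈ Finset.range n, c i • tail r.length x i)) := by
        have hterm : ∀ i, φ (c i • tail r.length x i) = ((s i * ‖c i‖ : ℝ) : 𝕜) := fun i => by
          rw [map_smul, smul_eq_mul, tail, hφs, Nat.add_sub_cancel_left, RCLike.ofReal_mul, hτc]
          ring
        rw [map_sum, map_sum]
        simp only [hterm, RCLike.ofReal_re]
    _ ≤ ‖∑ i ∈ Finset.range n, c i • tail r.length x i‖ :=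
        (RCLike.re_le_norm _).trans (φ.le_of_opNorm_le hφ.le _ |>.trans_eq (one_mul _))

end Forcing

section Main

variable {𝕜 : Type*} [RCLike 𝕜] {F : Type*} [NormedAddCommGroup F] [NormedSpace 𝕜 F]
  {δ B : ℕ → ℝ} {C D : ℝ}

section Transfer

variable {X : Type*} [NormedAddCommGroup X] [NormedSpace 𝕜 X] {e : ℕ → X}

lemma exists_dominatedWith_of_tail_left (hδ : ∀ i, 0 ≤ δ i) (hC : 0 ≤ C)
    (hB : CoeffBound 𝕜 B e) (hD : DominatedWith 𝕜 D (weightedL1Basis 𝕜 δ) e) (p : ℕ) :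
    ∃ C', ∀ x w : ℕ → F, (∀ i, ‖w i‖ = 1) → (∀ i, ‖x i - w i‖ ≤ 3 * δ i) →
      DominatedWith 𝕜 C (tail p w) (tail p e) → DominatedWith 𝕜 C' x e :=
  ⟨_, fun _ _ hw hxw hwe => .perturb hδ zero_le_three hxw
    (.of_tail (α := fun _ => 1) hC hB (fun i => (hw i).le) (fun _ => le_rfl) hwe) hD⟩

lemma exists_dominatedWith_of_tail_right (hδ : ∀ i, 0 < δ i) (hC : 0 ≤ C) (D : ℝ)
    (e : ℕ → X) (p : ℕ) : ∃ C', ∀ x w : ℕ → F, (∀ i, ‖x i‖ = 1) → (∀ i, ‖x i - w i‖ ≤ 3 * δ i) →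
      DominatedWith 𝕜 D (weightedL1Basis 𝕜 δ) x →
      DominatedWith 𝕜 C (tail p e) (tail p w) → DominatedWith 𝕜 C' e x := by
  refine ⟨_, fun x w hx hxw hl1 hew => .of_tail (C := C * (1 + 3 * |D|)) (β := fun _ => 1)
    (by positivity) (hl1.coeffBound hδ) (fun _ => le_rfl) (fun i => (hx i).le)
    (hew.trans hC (.tail ?_ p))⟩
  exact .perturb (fun i => (hδ i).le) zero_le_three (fun i => (norm_sub_rev _ _).trans_le (hxw i))
    (.refl x) (hl1.mono (le_abs_self D))

end Transfer

variable {S : ℕ → Submodule 𝕜 F} {hS : IsFDD S} {E : Submodule 𝕜 F} {K : ℝ}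
  {ι : Type*} [Countable ι] {X : ι → Type*} [∀ k, NormedAddCommGroup (X k)]
  [∀ k, NormedSpace 𝕜 (X k)] {e : ∀ k, ℕ → X k}

theorem exists_uniform_upper_estimate (hK : hS.ConstantLE K)
    (hE : ¬ FiniteDimensional 𝕜 E) (hδ : ∀ i, 0 < δ i) (hbdd : BddAbove (Set.range δ))
    (he : ∀ k, ∃ B, CoeffBound 𝕜 B (e k))
    (htree : ∀ T, IsBlockTree hS E δ T → ∃ x, IsBranch T x ∧ ∃ k, Dominated 𝕜 x (e k)) :
    ∃ (C : ℝ) (k : ι) (m : ℕ → ℕ), StrictMono m ∧ ∀ x, IsBlock hS E δ x →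
      BlockSeparatedBy hS δ m x → DominatedWith 𝕜 C x (e k) := by
  obtain ⟨⟨k, C⟩, r, hr, m, hm, hsep⟩ := exists_not_forces_and_separating hK hE hδ
    (J := ι × ℕ) (A := fun j p => {x | DominatedWith 𝕜 j.2 x (tail p (e j.1))})
    (fun _ _ => isPrefixOpen_compl_setOf_dominatedWith_left _ _) fun T hT => by
      obtain ⟨x, hx, k, hk⟩ := htree T hT
      obtain ⟨C, hC⟩ := hk.exists_nat
      exact ⟨x, hx, (k, C), hC.tail⟩
  obtain ⟨B, hB⟩ := he k
  obtain ⟨D, hD⟩ : Dominated 𝕜 (weightedL1Basis 𝕜 δ) (e k) :=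
    by_contra fun h => hr (forces_not_dominatedWith hK hE hδ hbdd hB h C.cast_nonneg r)
  obtain ⟨C', hC'⟩ := exists_dominatedWith_of_tail_left (F := F) (fun i => (hδ i).le)
    C.cast_nonneg hB hD r.length
  refine ⟨C', k, m, hm, fun x hx hxm => ?_⟩
  obtain ⟨w, hw, hxw, hwe⟩ := hsep x hx.1 hxm
  exact hC' x w (fun i => (hw i).2) hxw hwe

theorem exists_uniform_lower_estimate (hK : hS.ConstantLE K)
    (hE : ¬ FiniteDimensional 𝕜 E) (hδ : ∀ i, 0 < δ i) (hsum : Summable δ)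
    (hsmall : (2 * K + 1) * ∑' i, δ i < 1)
    (htree : ∀ T, IsBlockTree hS E δ T → ∃ x, IsBranch T x ∧ ∃ k, Dominated 𝕜 (e k) x) :
    ∃ (C : ℝ) (k : ι) (m : ℕ → ℕ), StrictMono m ∧ ∀ x, IsBlock hS E δ x →
      BlockSeparatedBy hS δ m x → DominatedWith 𝕜 C (e k) x := by
  obtain ⟨⟨k, C⟩, r, -, m, hm, hsep⟩ := exists_not_forces_and_separating hK hE hδ
    (J := ι × ℕ) (A := fun j p => {x | DominatedWith 𝕜 j.2 (tail p (e j.1)) x})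
    (fun _ _ => isPrefixOpen_compl_setOf_dominatedWith_right _ _) fun T hT => by
      obtain ⟨x, hx, k, hk⟩ := htree T hT
      obtain ⟨C, hC⟩ := hk.exists_nat
      exact ⟨x, hx, (k, C), hC.tail⟩
  obtain ⟨C', hC'⟩ := exists_dominatedWith_of_tail_right (𝕜 := 𝕜) (F := F) hδ C.cast_nonneg _ (e k)
    r.length
  refine ⟨C', k, m, hm, fun x hx hxm => ?_⟩
  obtain ⟨w, -, hxw, hew⟩ := hsep x hx.1 hxm
  exact hC' x w (fun i => (hx.1 i).2) hxw (hx.weightedL1Basis_dominatedWith hK hsum hsmall) hew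

theorem exists_uniform_equivalence (hK : hS.ConstantLE K)
    (hE : ¬ FiniteDimensional 𝕜 E) (hδ : ∀ i, 0 < δ i) (hsum : Summable δ)
    (hsmall : (2 * K + 1) * ∑' i, δ i < 1) (he : ∀ k, ∃ B, CoeffBound 𝕜 B (e k))
    (htree : ∀ T, IsBlockTree hS E δ T → ∃ x, IsBranch T x ∧
      ∃ k, Dominated 𝕜 x (e k) ∧ Dominated 𝕜 (e k) x) :
    ∃ (C : ℝ) (k : ι) (m : ℕ → ℕ), StrictMono m ∧ ∀ x, IsBlock hS E δ x →
      BlockSeparatedBy hS δ m x → DominatedWith 𝕜 C x (e k) ∧ DominatedWith 𝕜 C (e k) x := by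
  obtain ⟨⟨k, C⟩, r, hr, m, hm, hsep⟩ := exists_not_forces_and_separating hK hE hδ (J := ι × ℕ)
    (A := fun j p => {x | DominatedWith 𝕜 j.2 x (tail p (e j.1))} ∩
      {x | DominatedWith 𝕜 j.2 (tail p (e j.1)) x})
    (fun _ _ => by
      rw [Set.compl_inter]
      exact (isPrefixOpen_compl_setOf_dominatedWith_left _ _).union
        (isPrefixOpen_compl_setOf_dominatedWith_right _ _)) fun T hT => by
      obtain ⟨x, hx, k, hk, hk'⟩ := htree T hT
      obtain ⟨C, hC⟩ := hk.exists_nat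
      obtain ⟨C', hC'⟩ := hk'.exists_nat
      refine ⟨x, hx, (k, max C C'), fun p => ⟨(hC.mono ?_).tail p, (hC'.mono ?_).tail p⟩⟩
      exacts [Nat.cast_le.2 (le_max_left _ _), Nat.cast_le.2 (le_max_right _ _)]
  obtain ⟨B, hB⟩ := he k
  obtain ⟨D, hD⟩ : Dominated 𝕜 (weightedL1Basis 𝕜 δ) (e k) := by_contra fun h => by
    have hforces := forces_not_dominatedWith hK hE hδ hsum.tendsto_atTop_zero.bddAbove_range hB h
      C.cast_nonneg r
    exact hr (hforces.mono <| Set.compl_subset_compl.2 fun _ h => h.1)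
  obtain ⟨C₁, hC₁⟩ := exists_dominatedWith_of_tail_left (F := F) (fun i => (hδ i).le)
    C.cast_nonneg hB hD r.length
  obtain ⟨C₂, hC₂⟩ := exists_dominatedWith_of_tail_right (𝕜 := 𝕜) (F := F) hδ C.cast_nonneg _ (e k)
    r.length
  refine ⟨max C₁ C₂, k, m, hm, fun x hx hxm => ?_⟩
  obtain ⟨w, hw, hxw, hwe, hew⟩ := hsep x hx.1 hxm
  exact ⟨(hC₁ x w (fun i => (hw i).2) hxw hwe).mono (le_max_left _ _),
    (hC₂ x w (fun i => (hx.1 i).2) hxw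
      (hx.weightedL1Basis_dominatedWith hK hsum hsmall) hew).mono (le_max_right _ _)⟩

theorem mainTheorem10_general (hK : hS.ConstantLE K) (hE : ¬ FiniteDimensional 𝕜 E)
    (hδ : ∀ i, 0 < δ i) (hbdd : BddAbove (Set.range δ)) (he : ∀ k, ∃ B, CoeffBound 𝕜 B (e k)) :
    ((∀ T, IsBlockTree hS E δ T → ∃ x, IsBranch T x ∧ ∃ k, Dominated 𝕜 x (e k)) →
      ∃ (C : ℝ) (k : ι) (m : ℕ → ℕ), StrictMono m ∧ ∀ x, IsBlock hS E δ x →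
        BlockSeparatedBy hS δ m x → DominatedWith 𝕜 C x (e k)) ∧
    (Summable δ → (2 * K + 1) * ∑' i, δ i < 1 →
      ((∀ T, IsBlockTree hS E δ T → ∃ x, IsBranch T x ∧ ∃ k, Dominated 𝕜 (e k) x) →
        ∃ (C : ℝ) (k : ι) (m : ℕ → ℕ), StrictMono m ∧ ∀ x, IsBlock hS E δ x →
          BlockSeparatedBy hS δ m x → DominatedWith 𝕜 C (e k) x) ∧
      ((∀ T, IsBlockTree hS E δ T → ∃ x, IsBranch T x ∧
          ∃ k, Dominated 𝕜 x (e k) ∧ Dominated 𝕜 (e k) x) →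
        ∃ (C : ℝ) (k : ι) (m : ℕ → ℕ), StrictMono m ∧ ∀ x, IsBlock hS E δ x →
          BlockSeparatedBy hS δ m x →
            DominatedWith 𝕜 C x (e k) ∧ DominatedWith 𝕜 C (e k) x)) :=
  ⟨exists_uniform_upper_estimate hK hE hδ hbdd he, fun hsum hsmall =>
    ⟨exists_uniform_lower_estimate hK hE hδ hsum hsmall,
      exists_uniform_equivalence hK hE hδ hsum hsmall he⟩⟩

end Main

end AsymptoticGames

theorem mainTheorem10 {𝕜 : Type*} [RCLike 𝕜]
    {F : Type*} [NormedAddCommGroup F] [NormedSpace 𝕜 F] [CompleteSpace F]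
    (S : ℕ → Submodule 𝕜 F) (hS : AsymptoticGames.IsFDD S)
    (E : Submodule 𝕜 F) (hEclosed : IsClosed (E : Set F)) (hEinf : ¬ FiniteDimensional 𝕜 E)
    (δ : ℕ → ℝ) (hδ : AsymptoticGames.IsPosNull δ)
    {ι : Type*} [Countable ι] (X : ι → Type*) [∀ k, NormedAddCommGroup (X k)]
    [∀ k, NormedSpace 𝕜 (X k)] [∀ k, CompleteSpace (X k)]
    (e : ∀ k, SchauderBasis 𝕜 (X k)) (he : ∀ k i, ‖e k i‖ = 1) :
    ((∀ T : Set (List F), AsymptoticGames.IsBlockTree hS E δ T →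
        ∃ x : ℕ → F, AsymptoticGames.IsBranch T x ∧
          ∃ k, AsymptoticGames.Dominated 𝕜 x (e k)) →
      ∃ (C : ℝ) (k : ι) (m : ℕ → ℕ), StrictMono m ∧
        ∀ x : ℕ → F, AsymptoticGames.IsBlock hS E δ x →
          AsymptoticGames.BlockSeparatedBy hS δ m x →
          AsymptoticGames.DominatedWith 𝕜 C x (e k)) ∧
    (∀ K : ℝ, hS.ConstantLE K → Summable δ → (2 * K + 1) * ∑' i, δ i < 1 →
      ((∀ T : Set (List F), AsymptoticGames.IsBlockTree hS E δ T →
          ∃ x : ℕ → F, AsymptoticGames.IsBranch T x ∧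
            ∃ k, AsymptoticGames.Dominated 𝕜 (e k) x) →
        ∃ (C : ℝ) (k : ι) (m : ℕ → ℕ), StrictMono m ∧
          ∀ x : ℕ → F, AsymptoticGames.IsBlock hS E δ x →
            AsymptoticGames.BlockSeparatedBy hS δ m x →
            AsymptoticGames.DominatedWith 𝕜 C (e k) x) ∧
      ((∀ T : Set (List F), AsymptoticGames.IsBlockTree hS E δ T →
          ∃ x : ℕ → F, AsymptoticGames.IsBranch T x ∧
            ∃ k, AsymptoticGames.Dominated 𝕜 x (e k) ∧
              AsymptoticGames.Dominated 𝕜 (e k) x) →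
        ∃ (C : ℝ) (k : ι) (m : ℕ → ℕ), StrictMono m ∧
          ∀ x : ℕ → F, AsymptoticGames.IsBlock hS E δ x →
            AsymptoticGames.BlockSeparatedBy hS δ m x →
            AsymptoticGames.DominatedWith 𝕜 C x (e k) ∧
              AsymptoticGames.DominatedWith 𝕜 C (e k) x)) := by
  obtain ⟨K₀, hK₀⟩ := hS.exists_constantLE
  have hbdd := hδ.tendsto_zero.bddAbove_range
  have hcoeff := fun k => (⟨_, AsymptoticGames.coeffBound_schauderBasis (e k)⟩ :
    ∃ B, AsymptoticGames.CoeffBound 𝕜 B (e k))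
  exact ⟨(AsymptoticGames.mainTheorem10_general hK₀ hEinf hδ.pos hbdd hcoeff).1,
    fun K hK => (AsymptoticGames.mainTheorem10_general hK hEinf hδ.pos hbdd hcoeff).2⟩
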